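/- **Theorem.** A real Banach space $(X,\|\cdot\|)$ has Rademacher type $p$ if there is a constant $T\in[0,\infty)$ such that for all $n$ and all $x_1,\dots,x_n\in X$, $$\mathbb E_{\varepsilon}\Big\|\sum_{j=1}^n\varepsilon_jx_j\Big\|^p\le T^p\sum_{j=1}^n\|x_j\|^p,$$ where $\varepsilon$ is uniformly distributed on $\{-1,1\}^n$; the smallest such $T$ is denoted by $T_p(X)$. There are an absolute constant $C$ and, for all real numbers $p$ and $T$, a constant $K(p,T)$ such that the following holds. Let $p\in[1,2]$, let $X$ be a Banach space of Rademacher type $p$, and let $n\ge 1$ be an integer. Then there is a positive integer $m$ divisible by $4$ with $$m\le C\,n^{2-1/p}\log(\max\{n,2\})$$ such that every $f:\mathbb Z_m^n\to X$, where $\mathbb Z_m=\mathbb Z/m\mathbb Z$, satisfies $$\mathbb E_{x,\varepsilon}\Big\|f\Big(x+\frac m2\varepsilon\Big)-f(x)\Big\|^p\le K(p,T_p(X))\,m^p\sum_{j=1}^n\mathbb E_x\|f(x+e_j)-f(x)\|^p.$$ Here $x$ and $\varepsilon$ are independent and uniformly distributed on $\mathbb Z_m^n$ and $\{-1,1\}^n$,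 and $e_1,\dots,e_n$ is the standard basis of $\mathbb Z_m^n$. -/

import Mathlib

open scoped BigOperators

/-- `X` has Rademacher type `p` with constant `T`. The sign group `ℤˣ` is `{-1, 1}`, and `𝔼` is the
average over a finite type, i.e. the expectation for the uniform probability measure. -/
def HasRademacherTypeWith (p T : ℝ) (X : Type*) [NormedAddCommGroup X] [NormedSpace ℝ X] : Prop :=
  0 ≤ T ∧ ∀ (n : ℕ) (x : Fin n → X),
    𝔼 ε : Fin n → ℤˣ, ‖∑ j, ((ε j : ℤ) : ℝ) • x j‖ ^ p ≤ T ^ p * ∑ j, ‖x j‖ ^ p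

/-- `X` has Rademacher type `p`. -/
def HasRademacherType (p : ℝ) (X : Type*) [NormedAddCommGroup X] [NormedSpace ℝ X] : Prop :=
  ∃ T : ℝ, HasRademacherTypeWith p T X

/-- The Rademacher type constant `T_p(X)`: the smallest `T` with which `X` has Rademacher type `p`
(see `isLeast_rademacherTypeConst`). -/
noncomputable def rademacherTypeConst (p : ℝ) (X : Type*) [NormedAddCommGroup X]
    [NormedSpace ℝ X] : ℝ :=
  sInf {T : ℝ | HasRademacherTypeWith p T X}

/-- The infimum defining `T_p(X)` is a minimum. -/
theorem isLeast_rademacherTypeConst (p : ℝ) (hp : 0 < p) (X : Type*) [NormedAddCommGroup X]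
    [NormedSpace ℝ X] (h : HasRademacherType p X) :
    IsLeast {T : ℝ | HasRademacherTypeWith p T X} (rademacherTypeConst p X) := by
  have hb : BddBelow {T : ℝ | HasRademacherTypeWith p T X} := ⟨0, fun T hT => hT.1⟩
  have hc : IsClosed {T : ℝ | HasRademacherTypeWith p T X} := by
    simp only [HasRademacherTypeWith, Set.ofPred_and, Set.ofPred_forall]
    refine IsClosed.inter (isClosed_le continuous_const continuous_id)
      (isClosed_iInter fun n => isClosed_iInter fun x => isClosed_le continuous_const ?_)
    exact (continuous_id.rpow_const fun _ => Or.inr hp.le).mul continuous_const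
  exact ⟨hc.csInf_mem h hb, fun T hT => csInf_le hb hT⟩

/-- The vector of `(ℤ/mℤ)^n` whose coordinates are the signs `ε`. -/
def signVec {n : ℕ} (m : ℕ) (ε : Fin n → ℤˣ) : Fin n → ZMod m :=
  fun i => ((ε i : ℤ) : ZMod m)

/-- The scaled Enflo type inequality with exponent `p` and constant `K` for functions
`f : (ℤ/mℤ)^n → X` (with `m ≠ 0`; it is meant for even `m`):
`𝔼_{x,ε} ‖f (x + (m/2) ε) - f x‖^p ≤ K m^p ∑_j 𝔼_x ‖f (x + e_j) - f x‖^p`. -/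
def ScaledEnfloInequality (p K : ℝ) (X : Type*) [NormedAddCommGroup X] (n m : ℕ) [NeZero m] :
    Prop :=
  ∀ f : (Fin n → ZMod m) → X,
    𝔼 x : Fin n → ZMod m, 𝔼 ε : Fin n → ℤˣ, ‖f (x + (m / 2) • signVec m ε) - f x‖ ^ p
      ≤ K * (m : ℝ) ^ p *
        ∑ j : Fin n, 𝔼 x : Fin n → ZMod m, ‖f (x + Pi.single j 1) - f x‖ ^ p

/-!
The idea is that Rademacher type `p` implies Enflo type `p` with no loss in the dimension, which
is stronger than what is needed: the scaled Enflo type inequality then holds for every `m` divisible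
by `4` (`HasRademacherTypeWith.scaledEnfloInequality`), so that the smallest such `m`, which is `4`,
serves for all `n`, although the bound on `m` would allow it to grow with `n`.

For Enflo type (`HasRademacherTypeWith.expect_norm_sub_neg_rpow_le`), join `ε ↦ g (-ε)` to `g` by
the path of functions `ε ↦ 𝔼 g (ε ξ)`, where `ξ` has independent signs with mean `sin θ` and `θ`
runs from `-π / 2` to `π / 2`. Its speed at `θ` is the function
`ε ↦ 𝔼_ξ ∑ j, δ_j • ∂_j g (ε ξ)`, where `δ_j` is `ξ j` centred and scaled to variance one, and
`∂_j g` is half the difference of `g` across the `j`-th edge (`hasDerivAt_noisePath`). As `ε ξ` is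
uniform and independent of `ξ`, the `p`-th power of the `L^p` norm of the speed is at most
`𝔼_ε 𝔼_ξ ‖∑ j, δ_j • ∂_j g ε‖ ^ p`, and symmetrization bounds this by
`2 T ^ p ∑ j, 𝔼 ‖∂_j g‖ ^ p`, because the `δ_j` are independent and centred with variance one
(`HasRademacherTypeWith.sum_signScore_le`). This bound does not depend on `θ` or on the dimension,
and the path has parameter length `π`.

For the torus, apply this to `g ε = f (x + (m / 4) ε)` and average over `x`: a sign change of `ε`
moves the argument by `(m / 2) ε`, and a change of its `j`-th sign moves it by `(m / 2) e_j`, which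
is a path of `m / 2` edges.
-/

/-! ### Biased signs -/

/-- The probability of the value `a` for a random sign with mean `sin θ`. -/
noncomputable def signDensity (θ : ℝ) (a : ℤˣ) : ℝ :=
  (1 + ((a : ℤ) : ℝ) * Real.sin θ) / 2

/-- The value `a` of a random sign with mean `sin θ`, centred and scaled to variance one. When
`cos θ = 0` the sign is constant, and division by zero makes the score zero as well, which is the
value that keeps the identities below valid for all `θ`. -/
noncomputable def signScore (θ : ℝ) (a : ℤˣ) : ℝ :=
  (((a : ℤ) : ℝ) - Real.sin θ) / Real.cos θ

/-- The probability of `ξ` for independent random signs with mean `sin θ`. -/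
noncomputable def noiseWeight {n : ℕ} (θ : ℝ) (ξ : Fin n → ℤˣ) : ℝ :=
  ∏ i, signDensity θ (ξ i)

/-- The sign vector with `-1` in coordinate `j` and `1` elsewhere; multiplication by it flips the
`j`-th sign. -/
def signFlip {n : ℕ} (j : Fin n) : Fin n → ℤˣ :=
  Pi.mulSingle j (-1)

theorem sum_signs {M : Type*} [AddCommMonoid M] (g : ℤˣ → M) : ∑ a, g a = g 1 + g (-1) := by
  rw [show (Finset.univ : Finset ℤˣ) = {1, -1} from rfl, Finset.sum_pair (by decide)]

theorem signDensity_nonneg (θ : ℝ) (a : ℤˣ) : 0 ≤ signDensity θ a := by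
  have h1 := Real.neg_one_le_sin θ
  have h2 := Real.sin_le_one θ
  rcases Int.units_eq_one_or a with rfl | rfl <;> simp [signDensity] <;> linarith

theorem sum_signDensity (θ : ℝ) : ∑ a, signDensity θ a = 1 := by
  rw [sum_signs]
  simp [signDensity]
  ring

theorem signDensity_mul_signScore (θ : ℝ) (a : ℤˣ) :
    signDensity θ a * signScore θ a = ((a : ℤ) : ℝ) * Real.cos θ / 2 := by
  by_cases hc : Real.cos θ = 0
  · simp [signScore, hc]
  have h := Real.sin_sq_add_cos_sq θ
  rw [signScore, signDensity, ← mul_div_assoc, div_eq_iff hc]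
  rcases Int.units_eq_one_or a with rfl | rfl <;> simp
  · linear_combination -h / 2
  · linear_combination h / 2

/-- The `p`-th moment of the difference of two independent scores is at most its second moment,
because the difference, when it is not zero, has absolute value at least `2`. -/
theorem sum_abs_signScore_sub_rpow_le {p : ℝ} (hp1 : 1 ≤ p) (hp2 : p ≤ 2) (θ : ℝ) :
    ∑ q : ℤˣ × ℤˣ, signDensity θ q.1 * signDensity θ q.2 *
      |signScore θ q.1 - signScore θ q.2| ^ p ≤ 2 := by
  have hp0 : p ≠ 0 := by linarith
  by_cases hc : Real.cos θ = 0
  · simp [signScore, hc, Real.zero_rpow hp0]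
  have h := Real.sin_sq_add_cos_sq θ
  have hsub : signScore θ 1 - signScore θ (-1) = 2 / Real.cos θ := by
    simp [signScore]
    ring
  have habs : |2 / Real.cos θ| ^ p ≤ 4 / Real.cos θ ^ 2 := by
    have hge : 1 ≤ |2 / Real.cos θ| := by
      rw [abs_div, le_div_iff₀ (abs_pos.2 hc)]
      have := Real.abs_cos_le_one θ
      norm_num
      linarith
    calc |2 / Real.cos θ| ^ p ≤ |2 / Real.cos θ| ^ (2 : ℝ) :=
          Real.rpow_le_rpow_of_exponent_le hge hp2
      _ = 4 / Real.cos θ ^ 2 := by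
          rw [Real.rpow_two, sq_abs]
          ring
  have hdens : signDensity θ 1 * signDensity θ (-1) = Real.cos θ ^ 2 / 4 := by
    simp [signDensity]
    linear_combination -h / 4
  rw [Fintype.sum_prod_type]
  simp only [sum_signs, sub_self, abs_zero, Real.zero_rpow hp0, mul_zero, zero_add, add_zero]
  rw [abs_sub_comm (signScore θ (-1)), mul_comm (signDensity θ (-1)), hsub, hdens]
  have : Real.cos θ ^ 2 / 4 * |2 / Real.cos θ| ^ p ≤ 1 := by
    calc _ ≤ Real.cos θ ^ 2 / 4 * (4 / Real.cos θ ^ 2) := by gcongr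
      _ = 1 := by field_simp
  linarith

/-- The marginal of a product weight. -/
theorem sum_prod_mul_apply {n : ℕ} {A : Type*} [Fintype A] (w h : A → ℝ)
    (hw : ∑ a, w a = 1) (j : Fin n) :
    ∑ q : Fin n → A, (∏ i, w (q i)) * h (q j) = ∑ a, w a * h a := by
  classical
  have key := Finset.prod_univ_sum (fun _ : Fin n => (Finset.univ : Finset A))
    (fun i a => w a * if i = j then h a else 1)
  rw [Fintype.piFinset_univ] at key
  simp only [Finset.prod_mul_distrib, Finset.prod_ite_eq', Finset.mem_univ, if_true] at key
  rw [← key, Finset.prod_eq_single j]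
  · simp
  · intro i _ hij
    simpa [hij] using hw
  · simp

theorem sum_prod_eq_one {n : ℕ} {A : Type*} [Fintype A] (w : A → ℝ) (hw : ∑ a, w a = 1) :
    ∑ q : Fin n → A, ∏ i, w (q i) = 1 := by
  classical
  have key := Finset.prod_univ_sum (fun _ : Fin n => (Finset.univ : Finset A)) (fun _ a => w a)
  rw [Fintype.piFinset_univ] at key
  rw [← key]
  simp [hw]

theorem noiseWeight_nonneg {n : ℕ} (θ : ℝ) (ξ : Fin n → ℤˣ) : 0 ≤ noiseWeight θ ξ :=
  Finset.prod_nonneg fun _ _ => signDensity_nonneg _ _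

theorem sum_noiseWeight (n : ℕ) (θ : ℝ) : ∑ ξ : Fin n → ℤˣ, noiseWeight θ ξ = 1 :=
  sum_prod_eq_one _ (sum_signDensity θ)

theorem noiseWeight_mul_signScore {n : ℕ} (θ : ℝ) (ξ : Fin n → ℤˣ) (j : Fin n) :
    noiseWeight θ ξ * signScore θ (ξ j) =
      (∏ i ∈ Finset.univ.erase j, signDensity θ (ξ i)) * (((ξ j : ℤ) : ℝ) * Real.cos θ / 2) := by
  rw [noiseWeight, ← Finset.mul_prod_erase _ _ (Finset.mem_univ j), ← signDensity_mul_signScore]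
  ring

theorem hasDerivAt_noiseWeight {n : ℕ} (θ : ℝ) (ξ : Fin n → ℤˣ) :
    HasDerivAt (fun t => noiseWeight t ξ) (∑ j, noiseWeight θ ξ * signScore θ (ξ j)) θ := by
  have h : ∀ i ∈ (Finset.univ : Finset (Fin n)), HasDerivAt (fun t => signDensity t (ξ i))
      (((ξ i : ℤ) : ℝ) * Real.cos θ / 2) θ := fun i _ =>
    (((Real.hasDerivAt_sin θ).const_mul _).const_add _).div_const _
  simp only [noiseWeight_mul_signScore]
  exact HasDerivAt.fun_finsetProd h

theorem noiseWeight_pi_div_two {n : ℕ} (ξ : Fin n → ℤˣ) :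
    noiseWeight (Real.pi / 2) ξ = if ξ = 1 then 1 else 0 := by
  split_ifs with h
  · simp [h, noiseWeight, signDensity]
  · obtain ⟨i, hi⟩ := Function.ne_iff.1 h
    refine Finset.prod_eq_zero (Finset.mem_univ i) ?_
    simp [signDensity, (Int.units_eq_one_or (ξ i)).resolve_left hi]

theorem noiseWeight_neg_pi_div_two {n : ℕ} (ξ : Fin n → ℤˣ) :
    noiseWeight (-(Real.pi / 2)) ξ = if ξ = -1 then 1 else 0 := by
  split_ifs with h
  · simp [h, noiseWeight, signDensity]
  · obtain ⟨i, hi⟩ := Function.ne_iff.1 h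
    refine Finset.prod_eq_zero (Finset.mem_univ i) ?_
    simp [signDensity, (Int.units_eq_one_or (ξ i)).resolve_right hi]

theorem noiseWeight_mul_signScore_flip {n : ℕ} (θ : ℝ) (ξ : Fin n → ℤˣ) (j : Fin n) :
    noiseWeight θ (ξ * signFlip j) * signScore θ ((ξ * signFlip j) j) =
      -(noiseWeight θ ξ * signScore θ (ξ j)) := by
  rw [noiseWeight_mul_signScore, noiseWeight_mul_signScore]
  have : ∏ i ∈ Finset.univ.erase j, signDensity θ ((ξ * signFlip j) i) =
      ∏ i ∈ Finset.univ.erase j, signDensity θ (ξ i) :=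
    Finset.prod_congr rfl fun i hi => by
      simp [signFlip, Pi.mulSingle_eq_of_ne (Finset.ne_of_mem_erase hi)]
  rw [this]
  simp [signFlip]
  ring

/-- A score has mean zero, also conditionally on the other signs. -/
theorem sum_noiseWeight_mul_signScore_smul_eq_zero {n : ℕ} {X : Type*} [AddCommGroup X]
    [Module ℝ X] (θ : ℝ) (j : Fin n) (g : (Fin n → ℤˣ) → X)
    (hg : ∀ ξ, g (ξ * signFlip j) = g ξ) :
    ∑ ξ, (noiseWeight θ ξ * signScore θ (ξ j)) • g ξ = 0 := by
  have hneg := Equiv.sum_comp (Equiv.mulRight (signFlip j))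
    fun ξ => (noiseWeight θ ξ * signScore θ (ξ j)) • g ξ
  simp only [Equiv.coe_mulRight, noiseWeight_mul_signScore_flip, hg, neg_smul,
    Finset.sum_neg_distrib] at hneg
  refine (smul_eq_zero_iff_right (two_ne_zero (α := ℝ))).1 ?_
  rw [two_smul]
  nth_rw 1 [← hneg]
  exact neg_add_cancel _

/-! ### Rademacher type for scores -/

theorem norm_sum_smul_rpow_le {ι X : Type*} [Fintype ι] [NormedAddCommGroup X] [NormedSpace ℝ X]
    {p : ℝ} (hp : 1 ≤ p) (w : ι → ℝ) (hw : ∀ i, 0 ≤ w i) (hw1 : ∑ i, w i = 1) (v : ι → X) :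
    ‖∑ i, w i • v i‖ ^ p ≤ ∑ i, w i * ‖v i‖ ^ p := by
  refine le_trans (Real.rpow_le_rpow (norm_nonneg _) ?_ (by linarith))
    (Real.rpow_arith_mean_le_arith_mean_rpow Finset.univ w (fun i => ‖v i‖) (fun i _ => hw i) hw1
      (fun i _ => norm_nonneg _) hp)
  refine (norm_sum_le _ _).trans_eq (Finset.sum_congr rfl fun i _ => ?_)
  rw [norm_smul, Real.norm_of_nonneg (hw i)]

/-- The type inequality with independent differences of scores in place of the signs. These
differences are symmetric: their joint law does not change when they are multiplied by signs. -/
theorem HasRademacherTypeWith.sum_signScore_sub_le {p T : ℝ} {X : Type*} [NormedAddCommGroup X]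
    [NormedSpace ℝ X] (hp1 : 1 ≤ p) (hp2 : p ≤ 2) (hT : HasRademacherTypeWith p T X) {n : ℕ}
    (θ : ℝ) (x : Fin n → X) :
    ∑ q : Fin n → ℤˣ × ℤˣ, (∏ i, signDensity θ (q i).1 * signDensity θ (q i).2) *
      ‖∑ j, (signScore θ (q j).1 - signScore θ (q j).2) • x j‖ ^ p ≤
      2 * T ^ p * ∑ j, ‖x j‖ ^ p := by
  set V : (Fin n → ℤˣ × ℤˣ) → ℝ := fun q => ∏ i, signDensity θ (q i).1 * signDensity θ (q i).2
  set v : ℤˣ × ℤˣ → ℝ := fun a => signScore θ a.1 - signScore θ a.2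
  have hV : ∀ q, 0 ≤ V q := fun q => Finset.prod_nonneg fun i _ =>
    mul_nonneg (signDensity_nonneg _ _) (signDensity_nonneg _ _)
  -- Swapping the two signs of the pairs `j` with `r j = -1` multiplies the differences by `r`.
  have hsymm : ∀ r : Fin n → ℤˣ, ∑ q, V q * ‖∑ j, v (q j) • x j‖ ^ p =
      ∑ q, V q * ‖∑ j, ((r j : ℤ) : ℝ) • v (q j) • x j‖ ^ p := by
    intro r
    let σ : (Fin n → ℤˣ × ℤˣ) ≃ (Fin n → ℤˣ × ℤˣ) := Equiv.piCongrRight fun j =>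
      if r j = 1 then Equiv.refl _ else Equiv.prodComm _ _
    have hσV : ∀ q, V (σ q) = V q := fun q => Finset.prod_congr rfl fun i _ => by
      by_cases h : r i = 1
      · simp [σ, h]
      · simp [σ, h, mul_comm]
    have hσv : ∀ q j, v (σ q j) = ((r j : ℤ) : ℝ) * v (q j) := fun q j => by
      by_cases h : r j = 1
      · simp [σ, h]
      · simp [σ, v, (Int.units_eq_one_or (r j)).resolve_left h]
    rw [← Equiv.sum_comp σ]
    simp only [hσV, hσv, mul_smul]
  have hw : ∑ a : ℤˣ × ℤˣ, signDensity θ a.1 * signDensity θ a.2 = 1 := by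
    rw [Fintype.sum_prod_type]
    simp only [← Finset.mul_sum, sum_signDensity, mul_one]
  calc ∑ q, V q * ‖∑ j, v (q j) • x j‖ ^ p
      = 𝔼 r : Fin n → ℤˣ, ∑ q, V q * ‖∑ j, ((r j : ℤ) : ℝ) • v (q j) • x j‖ ^ p := by
        rw [← Finset.expect_congr rfl fun r _ => hsymm r, Fintype.expect_const]
    _ = ∑ q, V q * 𝔼 r : Fin n → ℤˣ, ‖∑ j, ((r j : ℤ) : ℝ) • v (q j) • x j‖ ^ p := by
        simp only [Finset.expect_sum_comm, Finset.mul_expect]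
    _ ≤ ∑ q, V q * (T ^ p * ∑ j, ‖v (q j) • x j‖ ^ p) := by
        gcongr with q
        · exact hV q
        · exact hT.2 n _
    _ = T ^ p * ∑ j, (∑ q, V q * |v (q j)| ^ p) * ‖x j‖ ^ p := by
        simp only [norm_smul, Real.norm_eq_abs, Real.mul_rpow (abs_nonneg _) (norm_nonneg _),
          Finset.mul_sum, Finset.sum_mul]
        rw [Finset.sum_comm]
        exact Finset.sum_congr rfl fun _ _ => Finset.sum_congr rfl fun _ _ => by ring
    _ ≤ T ^ p * ∑ j, 2 * ‖x j‖ ^ p := by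
        have hT0 : 0 ≤ T ^ p := Real.rpow_nonneg hT.1 p
        gcongr with j
        exact (sum_prod_mul_apply (fun a : ℤˣ × ℤˣ => signDensity θ a.1 * signDensity θ a.2)
          (fun a => |v a| ^ p) hw j).trans_le (sum_abs_signScore_sub_rpow_le hp1 hp2 θ)
    _ = 2 * T ^ p * ∑ j, ‖x j‖ ^ p := by
        rw [← Finset.mul_sum]
        ring

/-- The type inequality with scores in place of the signs. -/
theorem HasRademacherTypeWith.sum_signScore_le {p T : ℝ} {X : Type*} [NormedAddCommGroup X]
    [NormedSpace ℝ X] (hp1 : 1 ≤ p) (hp2 : p ≤ 2) (hT : HasRademacherTypeWith p T X) {n : ℕ}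
    (θ : ℝ) (x : Fin n → X) :
    ∑ ξ : Fin n → ℤˣ, noiseWeight θ ξ * ‖∑ j, signScore θ (ξ j) • x j‖ ^ p ≤
      2 * T ^ p * ∑ j, ‖x j‖ ^ p := by
  refine le_trans ?_ (hT.sum_signScore_sub_le hp1 hp2 θ x)
  rw [← Equiv.sum_comp (Equiv.arrowProdEquivProdArrow (Fin n) (fun _ => ℤˣ) (fun _ => ℤˣ)).symm,
    Fintype.sum_prod_type]
  refine Finset.sum_le_sum fun ξ _ => ?_
  -- Jensen's inequality for an independent copy `η` of `ξ`, whose scores have mean zero.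
  have hmean : ∑ η : Fin n → ℤˣ, noiseWeight θ η •
      ∑ j, (signScore θ (ξ j) - signScore θ (η j)) • x j = ∑ j, signScore θ (ξ j) • x j := by
    simp only [sub_smul, Finset.sum_sub_distrib, smul_sub]
    rw [← Finset.sum_smul, sum_noiseWeight, one_smul, sub_eq_self]
    simp only [Finset.smul_sum, smul_smul]
    rw [Finset.sum_comm]
    exact Finset.sum_eq_zero fun j _ =>
      sum_noiseWeight_mul_signScore_smul_eq_zero θ j (fun _ => x j) fun _ => rfl
  rw [← hmean]
  refine (mul_le_mul_of_nonneg_left (norm_sum_smul_rpow_le hp1 _ (noiseWeight_nonneg θ)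
    (sum_noiseWeight n θ) _) (noiseWeight_nonneg θ ξ)).trans_eq ?_
  rw [Finset.mul_sum]
  refine Finset.sum_congr rfl fun η _ => ?_
  simp [noiseWeight, Equiv.arrowProdEquivProdArrow, Finset.prod_mul_distrib, mul_assoc]

/-! ### The Enflo type inequality on the cube -/

/-- The noise path of `g`, at level `θ`: the function `ε ↦ 𝔼 g (ε ξ)`, where `ξ` consists of
independent signs with mean `sin θ`, as an element of `L^p` of the cube with counting measure. -/
noncomputable def noisePath {n : ℕ} {X : Type*} [NormedAddCommGroup X] [NormedSpace ℝ X]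
    (p : ENNReal) (g : (Fin n → ℤˣ) → X) (θ : ℝ) : PiLp p fun _ : Fin n → ℤˣ => X :=
  ∑ ξ, noiseWeight θ ξ • WithLp.toLp p fun ε => g (ε * ξ)

theorem PiLp.norm_rpow_eq_sum {ι X : Type*} [Fintype ι] [NormedAddCommGroup X] {p : ℝ}
    (hp : 0 < p) (f : PiLp (ENNReal.ofReal p) fun _ : ι => X) : ‖f‖ ^ p = ∑ i, ‖f i‖ ^ p := by
  have h : (ENNReal.ofReal p).toReal = p := ENNReal.toReal_ofReal hp.le
  rw [PiLp.norm_eq_sum (by rwa [h]), h, ← Real.rpow_mul (Finset.sum_nonneg fun _ _ =>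
    Real.rpow_nonneg (norm_nonneg _) _), one_div_mul_cancel hp.ne', Real.rpow_one]

section NoisePath

variable {n : ℕ} {X : Type*} [NormedAddCommGroup X] [NormedSpace ℝ X]

theorem noisePath_pi_div_two_apply (p : ENNReal) (g : (Fin n → ℤˣ) → X) (ε : Fin n → ℤˣ) :
    noisePath p g (Real.pi / 2) ε = g ε := by
  simp [noisePath, noiseWeight_pi_div_two]

theorem noisePath_neg_pi_div_two_apply (p : ENNReal) (g : (Fin n → ℤˣ) → X) (ε : Fin n → ℤˣ) :
    noisePath p g (-(Real.pi / 2)) ε = g (-ε) := by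
  simp [noisePath, noiseWeight_neg_pi_div_two]

/-- The speed of the noise path. A score is orthogonal to everything that does not depend on its
sign, so it sees only the half-difference of `g` in its direction. -/
theorem hasDerivAt_noisePath (p : ENNReal) [Fact (1 ≤ p)] (g : (Fin n → ℤˣ) → X) (θ : ℝ) :
    HasDerivAt (noisePath p g)
      (∑ ξ, noiseWeight θ ξ • WithLp.toLp p fun ε =>
        ∑ j, signScore θ (ξ j) • (2⁻¹ : ℝ) • (g (ε * ξ) - g (ε * ξ * signFlip j))) θ := by
  have h : HasDerivAt (noisePath p g)
      (∑ ξ, (∑ j, noiseWeight θ ξ * signScore θ (ξ j)) • WithLp.toLp p fun ε => g (ε * ξ)) θ :=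
    HasDerivAt.fun_sum fun ξ _ => (hasDerivAt_noiseWeight θ ξ).smul_const _
  convert h using 1
  ext ε
  simp only [WithLp.ofLp_sum, WithLp.ofLp_smul, Finset.sum_apply, Pi.smul_apply,
    Finset.smul_sum, Finset.sum_smul, smul_smul _ (signScore θ _)]
  refine (Finset.sum_comm.trans (Finset.sum_congr rfl fun j _ => ?_)).trans Finset.sum_comm
  rw [← sub_eq_zero, ← Finset.sum_sub_distrib, ← neg_eq_zero, ← Finset.sum_neg_distrib]
  -- What is left of `g` is its mean over the `j`-th sign.
  convert sum_noiseWeight_mul_signScore_smul_eq_zero θ j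
    (fun ξ => (2⁻¹ : ℝ) • (g (ε * ξ) + g (ε * ξ * signFlip j))) ?_ using 2 with ξ
  · rw [← smul_sub, ← smul_neg]
    congr 1
    module
  · intro ξ
    have : signFlip j * signFlip j = 1 := by
      rw [signFlip, ← Pi.mulSingle_mul]
      simp
    rw [← mul_assoc, mul_assoc (ε * ξ), this, mul_one, add_comm]

/-- The speed of the noise path is bounded uniformly in `θ`: by Jensen's inequality it is at most
the `L^p` norm of `(ε, ξ) ↦ ∑ j, signScore θ (ξ j) • ∂_j g (ε ξ)`, and since `ε ξ` is uniform and
independent of `ξ`, the type inequality for scores applies with `∂_j g (ε)` as vectors. -/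
theorem norm_noisePath_deriv_rpow_le {p T : ℝ} (hp1 : 1 ≤ p) (hp2 : p ≤ 2)
    (hT : HasRademacherTypeWith p T X) (g : (Fin n → ℤˣ) → X) (θ : ℝ) :
    ‖∑ ξ, noiseWeight θ ξ • WithLp.toLp (ENNReal.ofReal p) fun ε =>
        ∑ j, signScore θ (ξ j) • (2⁻¹ : ℝ) • (g (ε * ξ) - g (ε * ξ * signFlip j))‖ ^ p ≤
      2 * T ^ p * ∑ ε, ∑ j, ‖g ε - g (ε * signFlip j)‖ ^ p := by
  have : Fact (1 ≤ ENNReal.ofReal p) := ⟨ENNReal.one_le_ofReal.2 hp1⟩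
  have hp0 : 0 < p := by linarith
  refine (norm_sum_smul_rpow_le hp1 _ (noiseWeight_nonneg θ) (sum_noiseWeight n θ) _).trans ?_
  simp only [PiLp.norm_rpow_eq_sum hp0, Finset.mul_sum]
  calc _ = ∑ ξ, ∑ ε, noiseWeight θ ξ *
        ‖∑ j, signScore θ (ξ j) • (2⁻¹ : ℝ) • (g ε - g (ε * signFlip j))‖ ^ p :=
        Finset.sum_congr rfl fun ξ _ => Equiv.sum_comp (Equiv.mulRight ξ) fun ε =>
          noiseWeight θ ξ * ‖∑ j, signScore θ (ξ j) • (2⁻¹ : ℝ) • (g ε - g (ε * signFlip j))‖ ^ p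
    _ = ∑ ε, ∑ ξ, noiseWeight θ ξ *
        ‖∑ j, signScore θ (ξ j) • (2⁻¹ : ℝ) • (g ε - g (ε * signFlip j))‖ ^ p :=
        Finset.sum_comm
    _ ≤ ∑ ε, 2 * T ^ p * ∑ j, ‖(2⁻¹ : ℝ) • (g ε - g (ε * signFlip j))‖ ^ p :=
        Finset.sum_le_sum fun ε _ => hT.sum_signScore_le hp1 hp2 θ _
    _ ≤ ∑ ε, 2 * T ^ p * ∑ j, ‖g ε - g (ε * signFlip j)‖ ^ p := by
        have hT0 : 0 ≤ T ^ p := Real.rpow_nonneg hT.1 p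
        gcongr with ε _ j
        rw [norm_smul, norm_inv, Real.norm_ofNat]
        linarith [norm_nonneg (g ε - g (ε * signFlip j))]
    _ = _ := by simp only [Finset.mul_sum]

/-- Rademacher type `p` implies Enflo type `p`. -/
theorem HasRademacherTypeWith.expect_norm_sub_neg_rpow_le {p T : ℝ} (hp1 : 1 ≤ p) (hp2 : p ≤ 2)
    (hT : HasRademacherTypeWith p T X) (g : (Fin n → ℤˣ) → X) :
    𝔼 ε, ‖g ε - g (-ε)‖ ^ p ≤
      2 * (Real.pi * T) ^ p * ∑ j, 𝔼 ε, ‖g ε - g (ε * signFlip j)‖ ^ p := by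
  have : Fact (1 ≤ ENNReal.ofReal p) := ⟨ENNReal.one_le_ofReal.2 hp1⟩
  have hp0 : 0 < p := by linarith
  set B : ℝ := 2 * T ^ p * ∑ ε, ∑ j, ‖g ε - g (ε * signFlip j)‖ ^ p
  have hB : 0 ≤ B := by
    have hT0 : 0 ≤ T ^ p := Real.rpow_nonneg hT.1 p
    positivity
  have hspeed := convex_univ.norm_image_sub_le_of_norm_hasDerivWithin_le (C := B ^ (1 / p))
    (fun θ _ => (hasDerivAt_noisePath (ENNReal.ofReal p) g θ).hasDerivWithinAt)
    (fun θ _ => by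
      rw [← Real.rpow_le_rpow_iff (norm_nonneg _) (Real.rpow_nonneg hB _) hp0,
        ← Real.rpow_mul hB, one_div_mul_cancel hp0.ne', Real.rpow_one]
      exact norm_noisePath_deriv_rpow_le hp1 hp2 hT g θ)
    (Set.mem_univ (-(Real.pi / 2))) (Set.mem_univ (Real.pi / 2))
  have hlen : ‖Real.pi / 2 - -(Real.pi / 2)‖ = Real.pi := by
    rw [sub_neg_eq_add, add_halves, Real.norm_of_nonneg Real.pi_pos.le]
  rw [hlen] at hspeed
  have hpow := Real.rpow_le_rpow (norm_nonneg _) hspeed hp0.le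
  rw [PiLp.norm_rpow_eq_sum hp0, Real.mul_rpow (Real.rpow_nonneg hB _) Real.pi_pos.le,
    ← Real.rpow_mul hB, one_div_mul_cancel hp0.ne', Real.rpow_one] at hpow
  simp only [PiLp.sub_apply, noisePath_pi_div_two_apply, noisePath_neg_pi_div_two_apply] at hpow
  rw [← Finset.expect_sum_comm, Fintype.expect_eq_sum_div_card, Fintype.expect_eq_sum_div_card,
    ← mul_div_assoc]
  gcongr
  refine hpow.trans_eq ?_
  rw [Real.mul_rpow Real.pi_pos.le hT.1]
  ring

end NoisePath

/-! ### From the cube to the discrete torus -/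

theorem expect_norm_add_nsmul_sub_rpow_le {G X : Type*} [AddCommGroup G] [Fintype G]
    [NormedAddCommGroup X] {p : ℝ} (hp : 1 ≤ p) (f : G → X) (e : G) (N : ℕ) :
    𝔼 x, ‖f (x + N • e) - f x‖ ^ p ≤ (N : ℝ) ^ p * 𝔼 x, ‖f (x + e) - f x‖ ^ p := by
  have hpt : ∀ x, ‖f (x + N • e) - f x‖ ^ p ≤
      (N : ℝ) ^ (p - 1) * ∑ i ∈ Finset.range N, ‖f (x + i • e + e) - f (x + i • e)‖ ^ p := by
    intro x
    have htel : f (x + N • e) - f x =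
        ∑ i ∈ Finset.range N, (f (x + i • e + e) - f (x + i • e)) := by
      have := Finset.sum_range_sub (fun i => f (x + i • e)) N
      simpa [succ_nsmul, add_assoc] using this.symm
    rw [htel]
    refine (Real.rpow_le_rpow (norm_nonneg _) (norm_sum_le _ _) (by linarith)).trans ?_
    simpa using Real.rpow_sum_le_const_mul_sum_rpow_of_nonneg (Finset.range N) hp
      (f := fun i => ‖f (x + i • e + e) - f (x + i • e)‖) fun i _ => norm_nonneg _
  have hshift : ∀ i : ℕ, 𝔼 x, ‖f (x + i • e + e) - f (x + i • e)‖ ^ p =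
      𝔼 x, ‖f (x + e) - f x‖ ^ p := fun i =>
    Fintype.expect_equiv (Equiv.addRight (i • e)) _ _ fun _ => rfl
  refine (Finset.expect_le_expect fun x _ => hpt x).trans_eq ?_
  rw [← Finset.mul_expect, Finset.expect_sum_comm]
  simp only [hshift, Finset.sum_const, Finset.card_range, nsmul_eq_mul]
  rcases eq_or_ne N 0 with rfl | hN
  · simp [Real.zero_rpow (show p ≠ 0 by linarith)]
  · rw [← mul_assoc, ← Real.rpow_add_one (by exact_mod_cast hN), sub_add_cancel]

theorem signVec_neg {n : ℕ} (m : ℕ) (ε : Fin n → ℤˣ) : signVec m (-ε) = -signVec m ε := by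
  ext i
  simp [signVec]

/-- On the torus, a step of length `m / 4` in direction `ε`, with the `j`-th sign flipped, differs
from the unflipped one by half a turn in the `j`-th coordinate. -/
theorem nsmul_signVec_mul_signFlip {n k : ℕ} (ε : Fin n → ℤˣ) (j : Fin n) :
    k • signVec (4 * k) (ε * signFlip j) =
      k • signVec (4 * k) ε + (2 * k) • Pi.single j (1 : ZMod (4 * k)) := by
  have h4 : (4 : ZMod (4 * k)) * k = 0 := by
    have := ZMod.natCast_self (4 * k)
    push_cast at this
    exact this
  ext i
  rcases eq_or_ne i j with rfl | hij
  · rcases Int.units_eq_one_or (ε i) with h | h <;> simp [signVec, signFlip, h]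
    · linear_combination -h4
    · ring
  · simp [signVec, signFlip, hij]

/-- The scaled Enflo type inequality holds for every `m` divisible by `4`: it is the Enflo type
inequality for the functions `ε ↦ f (x + (m / 4) ε)`, averaged over `x`. -/
theorem HasRademacherTypeWith.scaledEnfloInequality {p T : ℝ} {X : Type*} [NormedAddCommGroup X]
    [NormedSpace ℝ X] (hp1 : 1 ≤ p) (hp2 : p ≤ 2) (hT : HasRademacherTypeWith p T X) (n m : ℕ)
    [NeZero m] (hm : 4 ∣ m) : ScaledEnfloInequality p (2 * (Real.pi * T) ^ p) X n m := by
  obtain ⟨k, rfl⟩ := hm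
  intro f
  have hA : 0 ≤ (Real.pi * T) ^ p := Real.rpow_nonneg (mul_nonneg Real.pi_pos.le hT.1) p
  have hhalf : 4 * k / 2 = 2 * k := by omega
  calc 𝔼 x, 𝔼 ε, ‖f (x + (4 * k / 2) • signVec (4 * k) ε) - f x‖ ^ p
      = 𝔼 x, 𝔼 ε, ‖f (x + k • signVec (4 * k) ε) - f (x + k • signVec (4 * k) (-ε))‖ ^ p := by
        rw [Finset.expect_comm, Finset.expect_comm (f := fun x ε =>
          ‖f (x + k • signVec (4 * k) ε) - f (x + k • signVec (4 * k) (-ε))‖ ^ p)]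
        refine Finset.expect_congr rfl fun ε _ => ?_
        refine Fintype.expect_equiv (Equiv.addRight (k • signVec (4 * k) ε)) _ _ fun x => ?_
        rw [hhalf, signVec_neg, Equiv.coe_addRight, smul_neg, add_neg_cancel_right, add_assoc,
          ← add_smul, two_mul]
    _ ≤ 𝔼 x, 2 * (Real.pi * T) ^ p * ∑ j, 𝔼 ε, ‖f (x + k • signVec (4 * k) ε) -
          f (x + k • signVec (4 * k) (ε * signFlip j))‖ ^ p :=
        Finset.expect_le_expect fun x _ => hT.expect_norm_sub_neg_rpow_le hp1 hp2
          fun ε => f (x + k • signVec (4 * k) ε)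
    _ = 2 * (Real.pi * T) ^ p *
          ∑ j, 𝔼 x, ‖f (x + (2 * k) • Pi.single j (1 : ZMod (4 * k))) - f x‖ ^ p := by
        rw [← Finset.mul_expect, Finset.expect_sum_comm]
        congr 1
        refine Finset.sum_congr rfl fun j _ => ?_
        rw [Finset.expect_comm]
        refine (Finset.expect_congr rfl fun ε _ => ?_).trans
          (Fintype.expect_const (ι := Fin n → ℤˣ) _)
        refine Fintype.expect_equiv (Equiv.addRight (k • signVec (4 * k) ε)) _ _ fun x => ?_
        rw [nsmul_signVec_mul_signFlip, norm_sub_rev, Equiv.coe_addRight, add_assoc]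
    _ ≤ 2 * (Real.pi * T) ^ p * ∑ j, ((4 * k : ℕ) : ℝ) ^ p *
          𝔼 x, ‖f (x + Pi.single j 1) - f x‖ ^ p := by
        gcongr with j
        refine (expect_norm_add_nsmul_sub_rpow_le hp1 f _ _).trans ?_
        gcongr
        norm_num
    _ = 2 * (Real.pi * T) ^ p * ((4 * k : ℕ) : ℝ) ^ p *
          ∑ j, 𝔼 x, ‖f (x + Pi.single j 1) - f x‖ ^ p := by
        rw [← Finset.mul_sum, ← mul_assoc]

/-- `C` is the absolute constant in the bound on `m`, and `K` the constant of the inequality, which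
depends only on `p` and `T_p(X)`. The maximum is there only for `n = 1`, where `log n = 0`. -/
theorem theorem1p2 :
    ∃ C : ℝ, ∃ K : ℝ → ℝ → ℝ,
      ∀ (p : ℝ), 1 ≤ p → p ≤ 2 →
      ∀ (X : Type*) [NormedAddCommGroup X] [NormedSpace ℝ X] [CompleteSpace X],
        HasRademacherType p X →
        ∀ n : ℕ, 1 ≤ n →
          ∃ (m : ℕ) (_ : NeZero m), 4 ∣ m ∧
            (m : ℝ) ≤ C * ((n : ℝ) ^ (2 - 1 / p) * Real.log (max (n : ℝ) 2)) ∧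
            ScaledEnfloInequality p (K p (rademacherTypeConst p X)) X n m := by
  refine ⟨4 / Real.log 2, fun p T => 2 * (Real.pi * T) ^ p, ?_⟩
  intro p hp1 hp2 X _ _ _ hX n hn
  have hT : HasRademacherTypeWith p (rademacherTypeConst p X) X :=
    (isLeast_rademacherTypeConst p (by linarith) X hX).1
  -- Every multiple of `4` satisfies the inequality, so the least one meets the bound.
  refine ⟨4, inferInstance, dvd_rfl, ?_, hT.scaledEnfloInequality hp1 hp2 n 4 dvd_rfl⟩
  have hlog : 0 < Real.log 2 := Real.log_pos one_lt_two
  have hpow : (1 : ℝ) ≤ (n : ℝ) ^ (2 - 1 / p) := by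
    have : 1 / p ≤ 1 := (div_le_one (by linarith)).2 hp1
    exact Real.one_le_rpow (by exact_mod_cast hn) (by linarith)
  have hmax : Real.log 2 ≤ Real.log (max (n : ℝ) 2) :=
    Real.log_le_log two_pos (le_max_right _ _)
  calc ((4 : ℕ) : ℝ) = 4 / Real.log 2 * (1 * Real.log 2) := by
        field_simp
        norm_num
    _ ≤ 4 / Real.log 2 * ((n : ℝ) ^ (2 - 1 / p) * Real.log (max (n : ℝ) 2)) := by
        gcongr
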